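/- \textbf{Definitions.} Let $A\subseteq\mathbb R$. $A$ is \emph{$\aleph_1$-dense} if for all $a<b$ in $A$ the set $A\cap(a,b)$ has cardinality $\aleph_1$. A \emph{filtration} of an $\aleph_1$-dense set $A$ is a $\subseteq$-increasing, continuous sequence $(A_\alpha)_{\alpha<\omega_1}$ with $A_0=\emptyset$ and $\bigcup_{\alpha<\omega_1}A_\alpha=A$ such that every slice $A_{\alpha+1}\setminus A_\alpha$ is a countable dense subset of $A$. An $\aleph_1$-dense set $A$ is \emph{slicewise coverable} if for every filtration $(A_\alpha)_{\alpha<\omega_1}$ of $A$ there are partial functions $f_n:A\rightharpoonup A$ ($n<\omega$), each strictly increasing on its domain, such that, identifying functions with their graphs, $$\bigcup_{n<\omega}f_n=\bigcup_{\alpha<\omega_1}(A_{\alpha+1}\setminus A_\alpha)\times(A_{\alpha+1}\setminus A_\alpha).$$ Put $A^*=\{-r:r\in A\}$. Two sets $A,B\subseteq\mathbb R$ are \emph{near} if there are uncountable $A'\subseteq A$ and $B'\subseteq B$ that are order isomorphic, and \emph{far} otherwise. A forcing notion (a preordered set of conditions) $\mathbb Q$ is \emph{$\aleph_1$-preserving}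 if it forces that the ordinal $\omega_1$ of the ground model is uncountable. \textbf{Theorem.} Let $A\subseteq\mathbb R$ be dense in $\mathbb R$, $\aleph_1$-dense and slicewise coverable, and let $\mathbb Q$ be an $\aleph_1$-preserving forcing notion of cardinality $\aleph_1$. Then $\mathbb Q$ forces that $A$ and $A^*$ are far, i.e. every condition of $\mathbb Q$ forces that there is no order isomorphism between an uncountable subset of $A$ and an uncountable subset of $A^*$. -/

import Mathlib

open scoped Cardinal

universe u v

/-! ### Sets of reals -/

/-- `A` is `ℵ₁`-dense: between any two of its points there are exactly `ℵ₁` many points of `A`. -/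
def IsAlephOneDense (A : Set ℝ) : Prop :=
  ∀ a ∈ A, ∀ b ∈ A, a < b → #(A ∩ Set.Ioo a b : Set ℝ) = ℵ₁

/-- The reverse ordering `A* = {-r : r ∈ A}`. -/
def reverseOrder (A : Set ℝ) : Set ℝ := {x | ∃ r ∈ A, x = -r}

/-- The slice `F (α + 1) \ F α` of a sequence of sets of reals. -/
def slice (F : Ordinal.{0} → Set ℝ) (α : Ordinal.{0}) : Set ℝ := F (α + 1) \ F α

/-- `F` (only its values at `α < ω₁` matter) is a filtration of `A`: an increasing continuous
`ω₁`-sequence with `F 0 = ∅` and union `A`, all of whose slices are countable dense subsets of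
`A`. -/
structure IsSliceFiltration (A : Set ℝ) (F : Ordinal.{0} → Set ℝ) : Prop where
  mono : ∀ α β, α ≤ β → β < Ordinal.omega 1 → F α ⊆ F β
  continuous : ∀ γ, γ < Ordinal.omega 1 → Order.IsSuccLimit γ → F γ = ⋃ β < γ, F β
  zero : F 0 = ∅
  slice_countable : ∀ α, α < Ordinal.omega 1 → (slice F α).Countable
  slice_dense : ∀ α, α < Ordinal.omega 1 → A ⊆ closure (slice F α)
  iUnion_eq : A = ⋃ α < Ordinal.omega.{0} 1, F α

/-- `f` is the graph of a partial increasing function from `A` to `A`. -/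
structure IsPartialIncreasing (A : Set ℝ) (f : Set (ℝ × ℝ)) : Prop where
  subset : f ⊆ A ×ˢ A
  functional : ∀ x y z, (x, y) ∈ f → (x, z) ∈ f → y = z
  increasing : ∀ a b c d, (a, b) ∈ f → (c, d) ∈ f → a < c → b < d

/-- `A` is slicewise coverable: it is `ℵ₁`-dense and, for every filtration of `A`, the union of the
squares of the slices is the union of countably many partial increasing functions. -/
def SlicewiseCoverable (A : Set ℝ) : Prop :=
  IsAlephOneDense A ∧
    ∀ F : Ordinal.{0} → Set ℝ, IsSliceFiltration A F →
      ∃ f : ℕ → Set (ℝ × ℝ), (∀ n, IsPartialIncreasing A (f n)) ∧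
        (⋃ n, f n) = ⋃ α < Ordinal.omega 1, slice F α ×ˢ slice F α

/-! ### Formulas of set theory -/

/-- Formulas of the language of set theory with parameters from the class `V`; quantifiers range
over `V`. -/
inductive SetFormula (V : Type v) : Type v
  | mem (x y : V) : SetFormula V
  | eq (x y : V) : SetFormula V
  | not (φ : SetFormula V) : SetFormula V
  | and (φ ψ : SetFormula V) : SetFormula V
  | or (φ ψ : SetFormula V) : SetFormula V
  | imp (φ ψ : SetFormula V) : SetFormula V
  | all (φ : V → SetFormula V) : SetFormula V
  | ex (φ : V → SetFormula V) : SetFormula V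

namespace SetFormula

variable {V : Type v}

def iff (φ ψ : SetFormula V) : SetFormula V := and (imp φ ψ) (imp ψ φ)

/-- `∀ y ∈ x, φ y` -/
def ball (x : V) (φ : V → SetFormula V) : SetFormula V := all fun y => imp (mem y x) (φ y)

/-- `∃ y ∈ x, φ y` -/
def bex (x : V) (φ : V → SetFormula V) : SetFormula V := ex fun y => and (mem y x) (φ y)

/-- `x ⊆ y` -/
def subset (x y : V) : SetFormula V := ball x fun z => mem z y

/-- `x ⊊ y`. Reals are left Dedekind cuts, so this is also the strict order `x < y` of reals. -/
def ssubset (x y : V) : SetFormula V := and (subset x y) (not (eq x y))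

/-- `z = {x, y}` -/
def isUnorderedPair (z x y : V) : SetFormula V :=
  all fun w => iff (mem w z) (or (eq w x) (eq w y))

/-- `z = (x, y) = {{x}, {x, y}}` -/
def isPair (z x y : V) : SetFormula V :=
  ex fun s => ex fun t =>
    and (isUnorderedPair s x x) (and (isUnorderedPair t x y) (isUnorderedPair z s t))

/-- `(x, y) ∈ f` -/
def pairMem (x y f : V) : SetFormula V := ex fun z => and (isPair z x y) (mem z f)

/-- `f` is a function from `X` to `Y`. -/
def isFunction (f X Y : V) : SetFormula V :=
  and (ball f fun z => bex X fun x => bex Y fun y => isPair z x y)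
    (ball X fun x => bex Y fun y =>
      and (pairMem x y f) (ball Y fun y' => imp (pairMem x y' f) (eq y' y)))

/-- `f` is an injection from `X` to `Y`. -/
def isInjection (f X Y : V) : SetFormula V :=
  and (isFunction f X Y)
    (ball X fun x => ball X fun x' => ball Y fun y =>
      imp (and (pairMem x y f) (pairMem x' y f)) (eq x x'))

/-- `f` is a bijection from `X` to `Y`. -/
def isBijection (f X Y : V) : SetFormula V :=
  and (isInjection f X Y) (ball Y fun y => bex X fun x => pairMem x y f)

/-- `X` is uncountable, where `ω` is the set of natural numbers: there is no injection from `X`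
to `ω`. -/
def isUncountable (ω X : V) : SetFormula V := not (ex fun f => isInjection f X ω)

/-- `f` is an order isomorphism between the sets of reals `X` and `Y`. -/
def isOrderIso (f X Y : V) : SetFormula V :=
  and (isBijection f X Y)
    (ball X fun x => ball X fun x' => ball Y fun y => ball Y fun y' =>
      imp (and (pairMem x y f) (pairMem x' y' f)) (iff (ssubset x x') (ssubset y y')))

/-- The sets of reals `A` and `B` are near: some uncountable `A' ⊆ A` and `B' ⊆ B` are
order isomorphic. -/
def near (ω A B : V) : SetFormula V :=
  ex fun A' => ex fun B' =>
    and (and (subset A' A) (subset B' B))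
      (and (and (isUncountable ω A') (isUncountable ω B')) (ex fun f => isOrderIso f A' B'))

/-- The sets of reals `A` and `B` are far. -/
def far (ω A B : V) : SetFormula V := not (near ω A B)

end SetFormula

/-! ### Forcing

A forcing notion is a preordered type `Q`, where `q ≤ p` means that `q` is stronger than `p`. The
ground model is `PSet`. -/

/-- `Q`-names: `mk ι x c` is the name `{(x i, c i) : i ∈ ι}`. -/
inductive ForcingName (Q : Type u) : Type (u + 1)
  | mk (ι : Type u) (x : ι → ForcingName Q) (c : ι → Q) : ForcingName Q

namespace ForcingName

variable {Q : Type u}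

/-- The canonical name `{(y̌, q) : y ∈ x, q ∈ Q}` of a ground model set `x`. (There need not be a
weakest condition, so all conditions are used.) -/
def check : PSet.{u} → ForcingName Q
  | ⟨ι, x⟩ => ⟨ι × Q, fun i => check (x i.1), fun i => i.2⟩

variable [Preorder Q]

/-- `p ⊩ x = y`: whenever `q ≤ p` and `q ≤ c` for some `(z, c)` in one of the two names, the
conditions below `q` which force `z` to be equal to an element of the other name are dense. -/
def ForcesEq : ForcingName Q → ForcingName Q → Q → Prop
  | ⟨_, x, c⟩, ⟨_, y, d⟩, p =>
    (∀ i, ∀ q ≤ p, q ≤ c i → ∃ r ≤ q, ∃ j, r ≤ d j ∧ ForcesEq (x i) (y j) r) ∧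
      (∀ j, ∀ q ≤ p, q ≤ d j → ∃ r ≤ q, ∃ i, r ≤ c i ∧ ForcesEq (x i) (y j) r)

/-- `p ⊩ x ∈ y`: densely below `p` there is `r` with `r ≤ d` and `r ⊩ x = z` for some
`(z, d)` in `y`. -/
def ForcesMem (x : ForcingName Q) : ForcingName Q → Q → Prop
  | ⟨_, y, d⟩, p => ∀ q ≤ p, ∃ r ≤ q, ∃ j, r ≤ d j ∧ ForcesEq x (y j) r

end ForcingName

section Forces

variable {Q : Type u} [Preorder Q]

/-- The forcing relation `p ⊩ φ`. -/
def Forces : Q → SetFormula (ForcingName Q) → Prop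
  | p, .mem x y => ForcingName.ForcesMem x y p
  | p, .eq x y => ForcingName.ForcesEq x y p
  | p, .not φ => ∀ q ≤ p, ¬ Forces q φ
  | p, .and φ ψ => Forces p φ ∧ Forces p ψ
  | p, .or φ ψ => ∀ q ≤ p, ∃ r ≤ q, Forces r φ ∨ Forces r ψ
  | p, .imp φ ψ => ∀ q ≤ p, Forces q φ → Forces q ψ
  | p, .all φ => ∀ x, Forces p (φ x)
  | p, .ex φ => ∀ q ≤ p, ∃ r ≤ q, ∃ x, Forces r (φ x)

end Forces

/-- `Q` forces `φ`: every condition forces `φ`. -/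
def ForcedBy (Q : Type u) [Preorder Q] (φ : SetFormula (ForcingName Q)) : Prop :=
  ∀ p : Q, Forces p φ

/-- `Q` preserves `ℵ₁`: it forces that the ground model's `ω₁` is uncountable. -/
def PreservesAlephOne (Q : Type u) [Preorder Q] : Prop :=
  ForcedBy Q (.isUncountable (.check PSet.omega) (.check (Ordinal.omega 1).toPSet))

/-! ### Reals as sets -/

/-- The real `r` as a set: the left Dedekind cut `{q ∈ ℚ : q < r}`, where rationals are coded by
natural numbers. -/
noncomputable def realPSet (r : ℝ) : PSet.{u} :=
  ⟨ULift {q : ℚ // (q : ℝ) < r}, fun q => PSet.ofNat (Encodable.encode q.down.val)⟩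

/-- A set of reals as a set. -/
noncomputable def realSetPSet (A : Set ℝ) : PSet.{u} :=
  ⟨ULift A, fun r => realPSet r.down.val⟩

open ForcingName

/-! ### Basic properties of the forcing relation -/

namespace ForcingName

variable {Q : Type u} [Preorder Q]

/-! Suppose `p` forces `f` to be an order isomorphism from an uncountable `A' ⊆ A` onto some `B' ⊆
A*`. Writing values of `f` as `-b`, the partial map `a ↦ b` from `A` to `A` is strictly decreasing,
so it shares at most one point with any increasing function.

For countable `C`, any condition below `p` has an extension forcing `f a = -b` for some `a, b ∈ A \
C`: otherwise every point of `A'` lies in `C` or is sent into `-C`, and `A'` is countable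
(`exists_forcesReflects_notMem`). Since `Q` has only `ℵ₁` conditions, a filtration `F` built in the
ground model can put such witnesses, for `C = F α` and the first `α` conditions, into its slice at
`α` (`IsAlephOneDense.exists_filtration`).

Let increasing functions `g n` cover the squares of the slices. By genericity `a ↦ b` meets the
squares of slices at unboundedly many `α < ω₁`, yet it meets each `g n` at most once, and the point
met determines `α`. So in the extension `ω₁` is a countable union of ordinals `α` that are countable
in the ground model, hence countable (`SlicewiseCoverable.forces_exists_injection`), against
preservation of `ℵ₁`. Generic filters are never used: the injection into `ω` is an explicit name,
built by `forces_exists_injection`. -/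

theorem ForcesEq.mono {x y : ForcingName Q} {p q : Q} (h : ForcesEq x y p) (hq : q ≤ p) :
    ForcesEq x y q := by
  cases x; cases y
  simp only [ForcesEq] at h ⊢
  exact ⟨fun i r hr => h.1 i r (hr.trans hq), fun i r hr => h.2 i r (hr.trans hq)⟩

theorem ForcesEq.of_dense {x y : ForcingName Q} {p : Q}
    (h : ∀ q ≤ p, ∃ r ≤ q, ForcesEq x y r) : ForcesEq x y p := by
  cases x; cases y
  simp only [ForcesEq] at h ⊢
  constructor
  · intro i q hq hi
    obtain ⟨r, hr, h1, -⟩ := h q hq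
    obtain ⟨s, hs, j, hj⟩ := h1 i r le_rfl (hr.trans hi)
    exact ⟨s, hs.trans hr, j, hj⟩
  · intro i q hq hi
    obtain ⟨r, hr, -, h1⟩ := h q hq
    obtain ⟨s, hs, j, hj⟩ := h1 i r le_rfl (hr.trans hi)
    exact ⟨s, hs.trans hr, j, hj⟩

theorem ForcesEq.refl (x : ForcingName Q) (p : Q) : ForcesEq x x p := by
  induction x generalizing p with
  | mk ι x c ih =>
    simp only [ForcesEq]
    exact ⟨fun i q _ hi => ⟨q, le_rfl, i, hi, ih i q⟩, fun i q _ hi => ⟨q, le_rfl, i, hi, ih i q⟩⟩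

theorem ForcesEq.symm {x y : ForcingName Q} {p : Q} (h : ForcesEq x y p) : ForcesEq y x p := by
  induction x generalizing y p with
  | mk ι x c ih =>
    cases y
    simp only [ForcesEq] at h ⊢
    constructor
    · intro i q hq hi
      obtain ⟨r, hr, j, hj, e⟩ := h.2 i q hq hi
      exact ⟨r, hr, j, hj, ih j e⟩
    · intro i q hq hi
      obtain ⟨r, hr, j, hj, e⟩ := h.1 i q hq hi
      exact ⟨r, hr, j, hj, ih i e⟩

theorem ForcesEq.trans {x y z : ForcingName Q} {p : Q} (h : ForcesEq x y p)
    (h' : ForcesEq y z p) : ForcesEq x z p := by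
  induction x generalizing y z p with
  | mk ι x c ih =>
    cases y; cases z
    simp only [ForcesEq] at h h' ⊢
    constructor
    · intro i q hq hi
      obtain ⟨r, hr, j, hj, e⟩ := h.1 i q hq hi
      obtain ⟨s, hs, k, hk, e'⟩ := h'.1 j r (hr.trans hq) hj
      exact ⟨s, hs.trans hr, k, hk, ih i (e.mono hs) e'⟩
    · intro k q hq hk
      obtain ⟨r, hr, j, hj, e⟩ := h'.2 k q hq hk
      obtain ⟨s, hs, i, hi, e'⟩ := h.2 j r (hr.trans hq) hj
      exact ⟨s, hs.trans hr, i, hi, ih i e' (e.mono hs)⟩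

theorem ForcesMem.mono {x y : ForcingName Q} {p q : Q} (h : ForcesMem x y p) (hq : q ≤ p) :
    ForcesMem x y q := by
  cases y
  simp only [ForcesMem] at h ⊢
  exact fun r hr => h r (hr.trans hq)

theorem ForcesMem.of_dense {x y : ForcingName Q} {p : Q}
    (h : ∀ q ≤ p, ∃ r ≤ q, ForcesMem x y r) : ForcesMem x y p := by
  cases y
  simp only [ForcesMem] at h ⊢
  intro q hq
  obtain ⟨r, hr, h1⟩ := h q hq
  obtain ⟨s, hs, j, hj⟩ := h1 r le_rfl
  exact ⟨s, hs.trans hr, j, hj⟩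

theorem ForcesMem.congr_left {x x' y : ForcingName Q} {p : Q} (h : ForcesMem x y p)
    (e : ForcesEq x x' p) : ForcesMem x' y p := by
  cases y
  simp only [ForcesMem] at h ⊢
  intro q hq
  obtain ⟨s, hs, j, hj, e'⟩ := h q hq
  exact ⟨s, hs, j, hj, (e.mono (hs.trans hq)).symm.trans e'⟩

theorem ForcesMem.congr_right {x y y' : ForcingName Q} {p : Q} (h : ForcesMem x y p)
    (e : ForcesEq y y' p) : ForcesMem x y' p := by
  cases y; cases y'
  simp only [ForcesMem, ForcesEq] at h e ⊢
  intro q hq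
  obtain ⟨s, hs, j, hj, e'⟩ := h q hq
  obtain ⟨t, ht, k, hk, e''⟩ := e.1 j s (hs.trans hq) hj
  exact ⟨t, ht.trans hs, k, hk, (e'.mono ht).trans e''⟩

theorem forcesMem_mk {ι : Type u} (x : ι → ForcingName Q) (c : ι → Q) {p : Q} {i : ι}
    (h : p ≤ c i) : ForcesMem (x i) (mk ι x c) p := by
  simp only [ForcesMem]
  exact fun q hq => ⟨q, le_rfl, i, hq.trans h, .refl _ _⟩

end ForcingName

section Forces

variable {Q : Type u} [Preorder Q]

theorem Forces.mono {φ : SetFormula (ForcingName Q)} {p q : Q} (h : Forces p φ) (hq : q ≤ p) :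
    Forces q φ := by
  induction φ generalizing p q with
  | mem x y => exact ForcesMem.mono h hq
  | eq x y => exact ForcesEq.mono h hq
  | not φ => exact fun r hr => h r (hr.trans hq)
  | and φ ψ h1 h2 => exact ⟨h1 h.1 hq, h2 h.2 hq⟩
  | or φ ψ => exact fun r hr => h r (hr.trans hq)
  | imp φ ψ => exact fun r hr => h r (hr.trans hq)
  | all φ ih => exact fun x => ih x (h x) hq
  | ex φ => exact fun r hr => h r (hr.trans hq)

/-- The clauses for atoms, `or` and `ex` already ask only for density below `p`, and the other
clauses inherit this. It allows a proof of `Forces p φ` to pass to stronger conditions that decide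
more. -/
theorem Forces.of_dense {φ : SetFormula (ForcingName Q)} {p : Q}
    (h : ∀ q ≤ p, ∃ r ≤ q, Forces r φ) : Forces p φ := by
  induction φ generalizing p with
  | mem x y => exact ForcesMem.of_dense h
  | eq x y => exact ForcesEq.of_dense h
  | not φ =>
    intro q hq hφ
    obtain ⟨r, hr, h1⟩ := h q hq
    exact h1 r le_rfl (hφ.mono hr)
  | and φ ψ h1 h2 =>
    exact ⟨h1 fun q hq => (h q hq).imp fun r hr => ⟨hr.1, hr.2.1⟩,
      h2 fun q hq => (h q hq).imp fun r hr => ⟨hr.1, hr.2.2⟩⟩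
  | or φ ψ =>
    intro q hq
    obtain ⟨r, hr, h1⟩ := h q hq
    obtain ⟨s, hs, h2⟩ := h1 r le_rfl
    exact ⟨s, hs.trans hr, h2⟩
  | imp φ ψ _ ih =>
    intro q hq hφ
    refine ih fun q' hq' => ?_
    obtain ⟨r, hr, h1⟩ := h q' (hq'.trans hq)
    exact ⟨r, hr, h1 r le_rfl (hφ.mono (hr.trans hq'))⟩
  | all φ ih =>
    exact fun x => ih x fun q hq => (h q hq).imp fun r hr => ⟨hr.1, hr.2 x⟩
  | ex φ =>
    intro q hq
    obtain ⟨r, hr, h1⟩ := h q hq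
    obtain ⟨s, hs, h2⟩ := h1 r le_rfl
    exact ⟨s, hs.trans hr, h2⟩

theorem Forces.ex_intro {φ : ForcingName Q → SetFormula (ForcingName Q)} {p : Q}
    (x : ForcingName Q) (h : Forces p (φ x)) : Forces p (.ex φ) :=
  fun q hq => ⟨q, le_rfl, x, h.mono hq⟩

/-! ### Pairs -/

open SetFormula

theorem Forces.isUnorderedPair_congr {z z' x x' y y' : ForcingName Q} {p : Q}
    (h : Forces p (isUnorderedPair z x y)) (hz : ForcesEq z z' p) (hx : ForcesEq x x' p)
    (hy : ForcesEq y y' p) : Forces p (isUnorderedPair z' x' y') := by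
  intro w
  obtain ⟨h1, h2⟩ := h w
  constructor
  · intro q hq hw q' hq'
    obtain ⟨r, hr, e | e⟩ := h1 q hq (ForcesMem.congr_right hw (hz.mono hq).symm) q' hq'
    · exact ⟨r, hr, .inl (ForcesEq.trans e (hx.mono (hr.trans (hq'.trans hq))))⟩
    · exact ⟨r, hr, .inr (ForcesEq.trans e (hy.mono (hr.trans (hq'.trans hq))))⟩
  · intro q hq hw
    refine ForcesMem.congr_right (h2 q hq fun q' hq' => ?_) (hz.mono hq)
    obtain ⟨r, hr, e | e⟩ := hw q' hq'
    · exact ⟨r, hr, .inl (ForcesEq.trans e (hx.mono (hr.trans (hq'.trans hq))).symm)⟩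
    · exact ⟨r, hr, .inr (ForcesEq.trans e (hy.mono (hr.trans (hq'.trans hq))).symm)⟩

theorem Forces.isPair_congr {z z' x x' y y' : ForcingName Q} {p : Q}
    (h : Forces p (isPair z x y)) (hz : ForcesEq z z' p) (hx : ForcesEq x x' p)
    (hy : ForcesEq y y' p) : Forces p (isPair z' x' y') := by
  intro q hq
  obtain ⟨r, hr, s, h⟩ := h q hq
  refine ⟨r, hr, s, fun q' hq' => ?_⟩
  obtain ⟨r', hr', t, h1, h2, h3⟩ := h q' hq'
  have hp := hr'.trans (hq'.trans (hr.trans hq))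
  have hx := hx.mono hp
  have hy := hy.mono hp
  exact ⟨r', hr', t, h1.isUnorderedPair_congr (.refl _ _) hx hx,
    h2.isUnorderedPair_congr (.refl _ _) hx hy,
    h3.isUnorderedPair_congr (hz.mono hp) (.refl _ _) (.refl _ _)⟩

theorem Forces.pairMem_congr {f x x' y y' : ForcingName Q} {p : Q}
    (h : Forces p (pairMem x y f)) (hx : ForcesEq x x' p) (hy : ForcesEq y y' p) :
    Forces p (pairMem x' y' f) := by
  intro q hq
  obtain ⟨r, hr, z, h1, h2⟩ := h q hq
  exact ⟨r, hr, z, h1.isPair_congr (.refl _ _) (hx.mono (hr.trans hq)) (hy.mono (hr.trans hq)), h2⟩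

theorem Forces.isUnorderedPair_mem {z x y w : ForcingName Q} {p : Q}
    (h : Forces p (isUnorderedPair z x y)) (hw : ForcesMem w z p) :
    ∃ q ≤ p, ForcesEq w x q ∨ ForcesEq w y q :=
  (h w).1 p le_rfl hw p le_rfl

theorem Forces.isUnorderedPair_left_mem {z x y : ForcingName Q} {p : Q}
    (h : Forces p (isUnorderedPair z x y)) : ForcesMem x z p :=
  (h x).2 p le_rfl fun q _ => ⟨q, le_rfl, .inl (ForcesEq.refl _ _)⟩

theorem Forces.isUnorderedPair_right_mem {z x y : ForcingName Q} {p : Q}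
    (h : Forces p (isUnorderedPair z x y)) : ForcesMem y z p :=
  (h y).2 p le_rfl fun q _ => ⟨q, le_rfl, .inr (ForcesEq.refl _ _)⟩

/-- Each of the four memberships is a disjunction that only some extension decides, hence the
passage to `q ≤ p`. -/
theorem Forces.isUnorderedPair_inj {z x y x' y' : ForcingName Q} {p : Q}
    (h : Forces p (isUnorderedPair z x y)) (h' : Forces p (isUnorderedPair z x' y')) :
    ∃ q ≤ p, (ForcesEq x x' q ∧ ForcesEq y y' q) ∨ (ForcesEq x y' q ∧ ForcesEq y x' q) := by
  obtain ⟨q₁, l₁, e₁⟩ := h'.isUnorderedPair_mem h.isUnorderedPair_left_mem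
  obtain ⟨q₂, l₂, e₂⟩ :=
    (h'.mono l₁).isUnorderedPair_mem (h.isUnorderedPair_right_mem.mono l₁)
  obtain ⟨q₃, l₃, e₃⟩ :=
    (h.mono (l₂.trans l₁)).isUnorderedPair_mem (h'.isUnorderedPair_left_mem.mono (l₂.trans l₁))
  obtain ⟨q₄, l₄, e₄⟩ := (h.mono (l₃.trans (l₂.trans l₁))).isUnorderedPair_mem
    (h'.isUnorderedPair_right_mem.mono (l₃.trans (l₂.trans l₁)))
  refine ⟨q₄, l₄.trans (l₃.trans (l₂.trans l₁)), ?_⟩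
  replace e₁ := e₁.imp (·.mono (l₄.trans (l₃.trans l₂))) (·.mono (l₄.trans (l₃.trans l₂)))
  replace e₂ := e₂.imp (·.mono (l₄.trans l₃)) (·.mono (l₄.trans l₃))
  replace e₃ := e₃.imp (·.mono l₄) (·.mono l₄)
  rcases e₁ with e₁ | e₁ <;> rcases e₂ with e₂ | e₂
  · rcases e₄ with e₄ | e₄
    · exact .inl ⟨e₁, (e₂.trans e₁.symm).trans e₄.symm⟩
    · exact .inl ⟨e₁, e₄.symm⟩
  · exact .inl ⟨e₁, e₂⟩
  · exact .inr ⟨e₁, e₂⟩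
  · rcases e₃ with e₃ | e₃
    · exact .inr ⟨e₁, (e₂.trans e₁.symm).trans e₃.symm⟩
    · exact .inr ⟨e₁, e₃.symm⟩

theorem Forces.isPair_inj {z x y x' y' : ForcingName Q} {p : Q}
    (h : Forces p (isPair z x y)) (h' : Forces p (isPair z x' y')) :
    ∃ q ≤ p, ForcesEq x x' q ∧ ForcesEq y y' q := by
  obtain ⟨q₁, l₁, s, h⟩ := h p le_rfl
  obtain ⟨q₂, l₂, t, hs, ht, hz⟩ := h q₁ le_rfl
  obtain ⟨q₃, l₃, s', h'⟩ := h' q₂ (l₂.trans l₁)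
  obtain ⟨q₄, l₄, t', hs', ht', hz'⟩ := h' q₃ le_rfl
  have l := l₄.trans l₃
  obtain ⟨q₅, l₅, ⟨e₁, e₂⟩ | ⟨e₁, e₂⟩⟩ := (hz.mono l).isUnorderedPair_inj hz'
  · have hs := (hs.mono (l₅.trans l)).isUnorderedPair_congr e₁ (.refl _ _) (.refl _ _)
    have ht := (ht.mono (l₅.trans l)).isUnorderedPair_congr e₂ (.refl _ _) (.refl _ _)
    obtain ⟨q₆, l₆, hx⟩ := hs.isUnorderedPair_inj (hs'.mono l₅)
    replace hx : ForcesEq x x' q₆ := hx.elim And.left And.left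
    obtain ⟨q₇, l₇, hy⟩ := (ht.mono l₆).isUnorderedPair_inj (ht'.mono (l₆.trans l₅))
    refine ⟨q₇, l₇.trans (l₆.trans (l₅.trans (l.trans (l₂.trans l₁)))), hx.mono l₇, ?_⟩
    rcases hy with ⟨_, b⟩ | ⟨a, b⟩
    · exact b
    · exact (b.trans (hx.mono l₇).symm).trans a
  -- The crossed case `{x} = {x', y'}` and `{x, y} = {x'}`, in which all four names are equal.
  · have hs := (hs.mono (l₅.trans l)).isUnorderedPair_congr e₁ (.refl _ _) (.refl _ _)
    have ht := (ht.mono (l₅.trans l)).isUnorderedPair_congr e₂ (.refl _ _) (.refl _ _)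
    obtain ⟨q₆, l₆, hx⟩ := hs.isUnorderedPair_inj (ht'.mono l₅)
    obtain ⟨q₇, l₇, hy⟩ := (ht.mono l₆).isUnorderedPair_inj (hs'.mono (l₆.trans l₅))
    have hx : ForcesEq x x' q₇ ∧ ForcesEq x y' q₇ := by
      rcases hx with ⟨a, b⟩ | ⟨a, b⟩
      · exact ⟨a.mono l₇, b.mono l₇⟩
      · exact ⟨b.mono l₇, a.mono l₇⟩
    refine ⟨q₇, l₇.trans (l₆.trans (l₅.trans (l.trans (l₂.trans l₁)))), hx.1, ?_⟩
    exact (hy.elim And.right And.right).trans (hx.1.symm.trans hx.2)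

namespace ForcingName

/-- The canonical name of `{x, y}`. -/
def upair (x y : ForcingName Q) : ForcingName Q :=
  ⟨ULift.{u} Bool × Q, fun i => bif i.1.down then x else y, fun i => i.2⟩

/-- The canonical name of `(x, y)`. -/
def opair (x y : ForcingName Q) : ForcingName Q := upair (upair x x) (upair x y)

end ForcingName

theorem forces_isUnorderedPair_upair (x y : ForcingName Q) (p : Q) :
    Forces p (isUnorderedPair (upair x y) x y) := by
  intro w
  constructor
  · intro q _ hw q' hq'
    obtain ⟨r, hr, ⟨⟨b⟩, s⟩, -, e⟩ := hw q' hq'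
    cases b
    · exact ⟨r, hr, .inr e⟩
    · exact ⟨r, hr, .inl e⟩
  · intro q _ hw q' hq'
    obtain ⟨r, hr, e | e⟩ := hw q' hq'
    · exact ⟨r, hr, ⟨⟨true⟩, r⟩, le_rfl, e⟩
    · exact ⟨r, hr, ⟨⟨false⟩, r⟩, le_rfl, e⟩

theorem forces_isPair_opair (x y : ForcingName Q) (p : Q) : Forces p (isPair (opair x y) x y) :=
  .ex_intro (upair x x) <| .ex_intro (upair x y) ⟨forces_isUnorderedPair_upair _ _ _,
    forces_isUnorderedPair_upair _ _ _, forces_isUnorderedPair_upair _ _ _⟩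

end Forces

/-! ### Canonical names of ground model sets -/

section Check

variable {Q : Type u} [Preorder Q]

open SetFormula

/-- Statements about canonical names do not depend on the condition: each element is paired with
every condition, so any condition can be its own witness. -/
theorem forcesEq_check_iff {x y : PSet.{u}} {p : Q} :
    ForcesEq (check x) (check y) p ↔ PSet.Equiv x y := by
  induction x generalizing y p with
  | mk ι x ih =>
    cases y
    simp only [check, ForcesEq, PSet.Equiv]
    constructor
    · rintro ⟨h1, h2⟩
      constructor
      · intro i
        obtain ⟨r, -, j, -, e⟩ := h1 (i, p) p le_rfl le_rfl
        exact ⟨j.1, (ih i).1 e⟩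
      · intro j
        obtain ⟨r, -, i, -, e⟩ := h2 (j, p) p le_rfl le_rfl
        exact ⟨i.1, (ih i.1).1 e⟩
    · rintro ⟨h1, h2⟩
      constructor
      · intro i q _ _
        obtain ⟨j, hj⟩ := h1 i.1
        exact ⟨q, le_rfl, (j, q), le_rfl, (ih i.1).2 hj⟩
      · intro j q _ _
        obtain ⟨i, hi⟩ := h2 j.1
        exact ⟨q, le_rfl, (i, q), le_rfl, (ih i).2 hi⟩

theorem ForcingName.ForcesMem.exists_mem {x : PSet.{u}} {w : ForcingName Q} {p : Q}
    (h : ForcesMem w (check x) p) : ∃ q ≤ p, ∃ y ∈ x, ForcesEq w (check y) q := by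
  cases x
  obtain ⟨r, hr, j, -, e⟩ := h p le_rfl
  exact ⟨r, hr, _, ⟨j.1, .refl _⟩, e⟩

theorem forcesMem_check_iff {x y : PSet.{u}} {p : Q} :
    ForcesMem (check x) (check y) p ↔ x ∈ y := by
  constructor
  · intro h
    obtain ⟨q, -, z, hz, e⟩ := h.exists_mem
    exact (PSet.Mem.congr_left (forcesEq_check_iff.1 e)).2 hz
  · cases y
    rintro ⟨j, hj⟩
    exact fun q _ => ⟨q, le_rfl, (j, q), le_rfl, forcesEq_check_iff.2 hj⟩

theorem forces_subset_check_iff {x y : PSet.{u}} {p : Q} :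
    Forces p (subset (check x) (check y)) ↔ x ⊆ y := by
  constructor
  · intro h
    refine PSet.subset_iff.2 fun z hz => ?_
    exact forcesMem_check_iff.1 (h (check z) p le_rfl (forcesMem_check_iff.2 hz))
  · intro h w q _ hw
    refine Forces.of_dense fun q' hq' => ?_
    obtain ⟨r, hr, z, hz, e⟩ := (ForcesMem.mono hw hq').exists_mem
    exact ⟨r, hr, (forcesMem_check_iff.2 (PSet.mem_of_subset h hz)).congr_left e.symm⟩

end Check

/-! ### Codes of natural numbers and reals -/

theorem PSet.rank_ofNat (n : ℕ) : (PSet.ofNat.{u} n).rank = n := by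
  induction n with
  | zero => exact PSet.rank_empty
  | succ n ih =>
    rw [PSet.ofNat, PSet.rank_insert, ih, max_eq_left (Order.le_succ _)]
    simp

theorem PSet.ofNat_equiv_iff {m n : ℕ} : (PSet.ofNat.{u} m).Equiv (PSet.ofNat.{u} n) ↔ m = n := by
  refine ⟨fun h => ?_, fun h => h ▸ .refl _⟩
  have := PSet.rank_congr h
  rwa [PSet.rank_ofNat, PSet.rank_ofNat, Nat.cast_inj] at this

theorem PSet.ofNat_mem_omega (n : ℕ) : PSet.ofNat.{u} n ∈ PSet.omega.{u} := ⟨⟨n⟩, .refl _⟩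

theorem realPSet_subset_iff {r s : ℝ} : realPSet.{u} r ⊆ realPSet s ↔ r ≤ s := by
  constructor
  · intro h
    by_contra! hlt
    obtain ⟨q, h1, h2⟩ := exists_rat_btwn hlt
    obtain ⟨⟨q', hq'⟩, e⟩ := h ⟨⟨q, h2⟩⟩
    have hqq : q = q' := Encodable.encode_injective (PSet.ofNat_equiv_iff.1 e)
    subst hqq
    exact h1.not_gt hq'
  · rintro h ⟨q, hq⟩
    exact ⟨⟨q, hq.trans_le h⟩, .refl _⟩

theorem realPSet_equiv_iff {r s : ℝ} : (realPSet.{u} r).Equiv (realPSet.{u} s) ↔ r = s := by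
  rw [PSet.Equiv.ext, realPSet_subset_iff, realPSet_subset_iff, le_antisymm_iff]

theorem mem_realSetPSet_iff {A : Set ℝ} {x : PSet.{u}} :
    x ∈ realSetPSet A ↔ ∃ r ∈ A, x.Equiv (realPSet.{u} r) :=
  ⟨fun ⟨⟨r⟩, h⟩ => ⟨r, r.2, h⟩, fun ⟨r, hr, h⟩ => ⟨⟨⟨r, hr⟩⟩, h⟩⟩

/-! ### Order of reals and injections into `ω` in the extension -/

section Check

variable {Q : Type u} [Preorder Q]

open SetFormula

theorem forces_ssubset_realPSet_iff {r s : ℝ} {p : Q} :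
    Forces p (ssubset (check (realPSet r)) (check (realPSet s))) ↔ r < s := by
  rw [lt_iff_le_and_ne]
  refine and_congr (forces_subset_check_iff.trans realPSet_subset_iff) ⟨fun h e => ?_, ?_⟩
  · exact h p le_rfl (forcesEq_check_iff.2 (realPSet_equiv_iff.2 e))
  · exact fun h q _ e => h (realPSet_equiv_iff.1 (forcesEq_check_iff.1 e))

/-- A forced total relation between the elements of `X` and natural numbers which is injective
and respects equality yields an injection from `X` to `ω` in the extension. -/
theorem forces_exists_injection {X : ForcingName Q} {p : Q}
    (R : ForcingName Q → ℕ → Q → Prop)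
    (mono : ∀ x n q r, R x n q → r ≤ q → R x n r)
    (congr : ∀ x y n q, R x n q → ForcesEq x y q → R y n q)
    (total : ∀ x, ∀ q ≤ p, ForcesMem x X q → ∃ r ≤ q, ∃ n, R x n r)
    (inj : ∀ x y n q, R x n q → R y n q → ForcesEq x y q) :
    Forces p (.ex fun f => isInjection f X (check PSet.omega)) := by
  obtain ⟨ι, x, c⟩ := X
  -- `R` may relate `x` to several numbers. `S` selects the least one, minimal even among all
  -- extensions of `q`, which makes the relation functional while staying downward closed.
  let S : ForcingName Q → ℕ → Q → Prop := fun x n q => R x n q ∧ ∀ m < n, ∀ r ≤ q, ¬ R x m r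
  have S_mono : ∀ {x n q r}, S x n q → r ≤ q → S x n r := fun h hr =>
    ⟨mono _ _ _ _ h.1 hr, fun m hm s hs => h.2 m hm s (hs.trans hr)⟩
  have S_congr : ∀ {x y n q}, S x n q → ForcesEq x y q → S y n q := fun h e =>
    ⟨congr _ _ _ _ h.1 e, fun m hm s hs hR => h.2 m hm s hs (congr _ _ _ _ hR (e.mono hs).symm)⟩
  have S_func : ∀ {x m n q}, S x m q → S x n q → m = n := by
    intro x m n q hm hn
    rcases lt_trichotomy m n with h | h | h
    · exact (hn.2 _ h _ le_rfl hm.1).elim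
    · exact h
    · exact (hm.2 _ h _ le_rfl hn.1).elim
  have S_total : ∀ y, ∀ q ≤ p, ForcesMem y ⟨ι, x, c⟩ q → ∃ r ≤ q, ∃ n, S y n r := by
    intro y q hq hy
    classical
    have hex : ∃ n, ∃ r ≤ q, R y n r := by
      obtain ⟨r, hr, n, h⟩ := total y q hq hy
      exact ⟨n, r, hr, h⟩
    obtain ⟨r, hr, h⟩ := Nat.find_spec hex
    exact ⟨r, hr, _, h, fun m hm s hs hR => Nat.find_min hex hm ⟨s, hs.trans hr, hR⟩⟩
  -- Each pair carries a condition that both puts `x i` into `X` and decides its number.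
  let F : ForcingName Q :=
    ⟨{t : ι × ULift.{u} ℕ × Q // t.2.2 ≤ c t.1 ∧ S (x t.1) t.2.1.down t.2.2},
      fun t => opair (x t.1.1) (check (PSet.ofNat t.1.2.1.down)), fun t => t.1.2.2⟩
  have hF : ∀ {z q}, ForcesMem z F q → ∃ r ≤ q, ∃ i n, r ≤ c i ∧ S (x i) n r ∧
      ForcesEq z (opair (x i) (check (PSet.ofNat n))) r := by
    intro z q h
    obtain ⟨r, hr, ⟨⟨i, ⟨n⟩, s⟩, hs, hS⟩, hrs, e⟩ := h q le_rfl
    exact ⟨r, hr, i, n, le_trans hrs hs, S_mono hS hrs, e⟩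
  have hpair : ∀ {y z q}, Forces q (pairMem y z F) →
      ∃ r ≤ q, ∃ n, S y n r ∧ ForcesEq z (check (PSet.ofNat n)) r := by
    intro y z q h
    obtain ⟨q₁, l₁, w, h1, h2⟩ := h q le_rfl
    obtain ⟨q₂, l₂, i, n, -, hS, e⟩ := hF h2
    obtain ⟨q₃, l₃, e₁, e₂⟩ := ((h1.mono l₂).isPair_congr e (.refl _ _) (.refl _ _)).isPair_inj
      (forces_isPair_opair _ _ _)
    exact ⟨q₃, l₃.trans (l₂.trans l₁), n, S_congr (S_mono hS l₃) e₁.symm, e₂⟩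
  have hω : ∀ n (q : Q), ForcesMem (check (PSet.ofNat n)) (check PSet.omega) q := fun n q =>
    forcesMem_check_iff.2 (PSet.ofNat_mem_omega n)
  refine .ex_intro F ⟨⟨?_, ?_⟩, ?_⟩
  · intro z q _ hz q' hq'
    obtain ⟨r, hr, i, n, hi, -, e⟩ := hF (ForcesMem.mono hz hq')
    exact ⟨r, hr, x i, forcesMem_mk x c hi, .ex_intro _ ⟨hω n r,
      (forces_isPair_opair _ _ _).isPair_congr e.symm (.refl _ _) (.refl _ _)⟩⟩
  · intro y q hq hy q' hq'
    obtain ⟨q₁, l₁, i, hi, e⟩ := ForcesMem.mono hy hq' q' le_rfl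
    obtain ⟨q₂, l₂, n, hS⟩ :=
      S_total (x i) q₁ (l₁.trans (hq'.trans hq)) (forcesMem_mk x c hi)
    refine ⟨q₂, l₂.trans l₁, check (PSet.ofNat n), hω n q₂, ?_, ?_⟩
    · have : Forces q₂ (pairMem (x i) (check (PSet.ofNat n)) F) :=
        .ex_intro _ ⟨forces_isPair_opair _ _ _,
          fun r hr => ⟨r, le_rfl, ⟨⟨i, ⟨n⟩, q₂⟩, l₂.trans hi, hS⟩, hr, .refl _ _⟩⟩
      exact this.pairMem_congr (e.mono l₂).symm (.refl _ _)
    · intro z s hs _ t ht hz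
      refine ForcesEq.of_dense fun t' ht' => ?_
      obtain ⟨r, hr, m, hS', e'⟩ := hpair (hz.mono ht')
      have hr2 := hr.trans (ht'.trans (ht.trans hs))
      have := S_func (S_mono (S_congr hS (e.mono l₂).symm) hr2) hS'
      exact ⟨r, hr, this ▸ e'⟩
  · intro y q _ _ y' q' _ _ z q'' _ _ t _ h
    refine ForcesEq.of_dense fun t' ht' => ?_
    obtain ⟨r, hr, m, hS, e⟩ := hpair (h.1.mono ht')
    obtain ⟨s, hs, n, hS', e'⟩ := hpair (h.2.mono (hr.trans ht'))
    have hmn := PSet.ofNat_equiv_iff.1 (forcesEq_check_iff.1 ((e.mono hs).symm.trans e'))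
    subst hmn
    exact ⟨s, hs.trans hr, inj _ _ _ _ (S_mono hS hs).1 hS'.1⟩

end Check

/-! ### Filtrations with prescribed elements in the slices -/

theorem countable_Iio_of_lt_omega_one {α : Ordinal.{u}} (h : α < Ordinal.omega 1) :
    (Set.Iio α).Countable := by
  rw [← Cardinal.le_aleph0_iff_set_countable, Cardinal.mk_Iio_ordinal, Cardinal.lift_le_aleph0,
    ← Cardinal.lt_aleph_one_iff]
  exact Cardinal.lt_omega_iff_card_lt.1 h

theorem exists_enumeration_of_card_le_aleph_one {T : Type v} [Nonempty T] (h : #T ≤ ℵ₁) :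
    ∃ e : Ordinal.{0} → T, ∀ t, ∃ α < Ordinal.omega 1, e α = t := by
  have h1 : Cardinal.lift.{1} #T ≤ Cardinal.lift.{v} #(Set.Iio (Ordinal.omega.{0} 1)) := by
    rw [Cardinal.mk_Iio_ordinal, Ordinal.card_omega]
    simpa using h
  obtain ⟨f⟩ := Cardinal.lift_mk_le'.1 h1
  refine ⟨Function.invFun fun t => (f t : Ordinal), fun t => ⟨f t, (f t).2, ?_⟩⟩
  exact Function.leftInverse_invFun (Subtype.val_injective.comp f.injective) t

/-- `ℵ₁`-density only controls intervals with endpoints in `A`; density in `ℝ` makes countably many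
of them cover `A`. -/
theorem IsAlephOneDense.card_le {A : Set ℝ} (hA₁ : IsAlephOneDense A) (hA : Dense A) :
    #A ≤ ℵ₁ := by
  have hlo : ∀ n : ℕ, ∃ a ∈ A, a < -(n : ℝ) := fun n => by
    obtain ⟨a, ha, h⟩ := hA.exists_lt (-(n : ℝ))
    exact ⟨a, ha, h⟩
  have hhi : ∀ n : ℕ, ∃ a ∈ A, (n : ℝ) < a := fun n => by
    obtain ⟨a, ha, h⟩ := hA.exists_gt (n : ℝ)
    exact ⟨a, ha, h⟩
  choose a haA ha using hlo
  choose b hbA hb using hhi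
  have hsub : A ⊆ ⋃ n, A ∩ Set.Ioo (a n) (b n) := by
    intro x hx
    obtain ⟨n, hn⟩ := exists_nat_gt |x|
    rw [abs_lt] at hn
    exact Set.mem_iUnion.2 ⟨n, hx, (ha n).trans hn.1, hn.2.trans (hb n)⟩
  refine (Cardinal.mk_le_mk_of_subset hsub).trans ((Cardinal.mk_iUnion_le _).trans ?_)
  have hcard : ∀ n, #(A ∩ Set.Ioo (a n) (b n) : Set ℝ) = ℵ₁ := fun n => by
    refine hA₁ _ (haA n) _ (hbA n) ((ha n).trans_le (le_trans ?_ (hb n).le))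
    have : (0 : ℝ) ≤ n := Nat.cast_nonneg n
    linarith
  simp only [hcard, ciSup_const, Cardinal.mk_nat]
  rw [Cardinal.aleph0_mul_eq Cardinal.aleph0_lt_aleph_one.le]

/-- Every real interval contains two points of `A`, hence `ℵ₁` many, too many for `C` to exhaust. -/
theorem IsAlephOneDense.dense_diff {A C : Set ℝ} (hA₁ : IsAlephOneDense A) (hA : Dense A)
    (hC : C.Countable) : Dense (A \ C) := by
  refine dense_of_exists_between fun x y hxy => ?_
  obtain ⟨a, ha, hxa, hay⟩ := hA.exists_between hxy
  obtain ⟨b, hb, hab, hby⟩ := hA.exists_between hay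
  by_contra! hne
  have hsub : A ∩ Set.Ioo a b ⊆ C := fun z hz => by
    by_contra hzC
    exact hne z ⟨hz.1, hzC⟩ ⟨hxa.trans hz.2.1, hz.2.2.trans hby⟩
  have := Cardinal.le_aleph0_iff_set_countable.2 (hC.mono hsub)
  rw [hA₁ a ha b hb hab] at this
  exact this.not_gt Cardinal.aleph0_lt_aleph_one

/-- An operation `W` that chooses countable subsets of co-countable pieces of `A` can be absorbed
into the slices of a filtration. -/
theorem IsAlephOneDense.exists_filtration {A : Set ℝ} (hA₁ : IsAlephOneDense A) (hA : Dense A)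
    (W : Ordinal.{0} → Set ℝ → Set ℝ)
    (hW : ∀ α < Ordinal.omega 1, ∀ C : Set ℝ, C.Countable → (W α C).Countable ∧ W α C ⊆ A \ C) :
    ∃ F, IsSliceFiltration A F ∧
      (∀ α < Ordinal.omega 1, (F α).Countable ∧ W α (F α) ⊆ slice F α) ∧
      ∀ α < Ordinal.omega 1, ∀ β < Ordinal.omega 1, ∀ x ∈ slice F α, x ∈ slice F β → α = β := by
  have hne : Nonempty A := hA.nonempty.to_subtype
  obtain ⟨e, he⟩ := exists_enumeration_of_card_le_aleph_one (hA₁.card_le hA)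
  have hD : ∀ C : Set ℝ, C.Countable → ∃ D ⊆ A \ C, D.Countable ∧ A ⊆ closure D := by
    intro C hC
    obtain ⟨D, h1, h2, h3⟩ :=
      (TopologicalSpace.IsSeparable.of_separableSpace (A \ C)).exists_countable_dense_subset
    refine ⟨D, h1, h2, fun x _ => ?_⟩
    rw [← closure_closure (s := D)]
    exact closure_mono h3 (hA₁.dense_diff hA hC x)
  choose! D hDA hDc hDd using hD
  -- The slice to be added on top of `C`: `D C` makes it dense, `e α` ensures that `A` is exhausted,
  -- and `W α C` is the prescribed part.
  let T : Ordinal.{0} → Set ℝ → Set ℝ := fun α C => D C ∪ ({(e α : ℝ)} \ C) ∪ W α C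
  have hT : ∀ α < Ordinal.omega 1, ∀ C : Set ℝ, C.Countable →
      (T α C).Countable ∧ T α C ⊆ A \ C := by
    intro α hα C hC
    refine ⟨((hDc C hC).union ((Set.countable_singleton _).mono Set.sdiff_subset)).union
      (hW α hα C hC).1, Set.union_subset (Set.union_subset (hDA C hC) ?_) (hW α hα C hC).2⟩
    rintro x ⟨rfl, hx⟩
    exact ⟨(e α).2, hx⟩
  obtain ⟨S, hS⟩ : ∃ S : Ordinal.{0} → Set ℝ, ∀ α, S α = T α (⋃ β < α, S β) :=
    ⟨WellFounded.fix (wellFounded_lt (α := Ordinal.{0})) fun α S => T α (⋃ β, ⋃ h : β < α, S β h),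
      fun α => WellFounded.fix_eq _ _ _⟩
  let F : Ordinal.{0} → Set ℝ := fun α => ⋃ β < α, S β
  have hSF : ∀ α, S α = T α (F α) := hS
  have hmemF : ∀ {x α}, x ∈ F α ↔ ∃ β < α, x ∈ S β := by simp [F]
  have hSc : ∀ α < Ordinal.omega 1, (S α).Countable := by
    intro α
    induction α using WellFoundedLT.induction with
    | ind α ih =>
      intro hα
      rw [hS]
      exact (hT α hα _ ((countable_Iio_of_lt_omega_one hα).biUnion
        fun β hβ => ih β hβ (lt_trans hβ hα))).1
  have hFc : ∀ α < Ordinal.omega 1, (F α).Countable := fun α hα =>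
    (countable_Iio_of_lt_omega_one hα).biUnion fun β hβ => hSc β (lt_trans hβ hα)
  have hSA : ∀ α < Ordinal.omega 1, S α ⊆ A \ F α := fun α hα => by
    rw [hSF]
    exact (hT α hα _ (hFc α hα)).2
  have hslice : ∀ α < Ordinal.omega 1, slice F α = S α := by
    intro α hα
    ext x
    simp only [slice, Set.mem_sdiff, hmemF, Order.lt_add_one_iff]
    constructor
    · rintro ⟨⟨β, hβ, hx⟩, h⟩
      rcases hβ.lt_or_eq with h' | rfl
      · exact (h ⟨β, h', hx⟩).elim
      · exact hx
    · exact fun hx => ⟨⟨α, le_rfl, hx⟩, fun h => (hSA α hα hx).2 (hmemF.2 h)⟩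
  refine ⟨F, ⟨?_, ?_, ?_, ?_, ?_, ?_⟩, ?_, ?_⟩
  · intro α β h _ x hx
    obtain ⟨γ, hγ, hx⟩ := hmemF.1 hx
    exact hmemF.2 ⟨γ, hγ.trans_le h, hx⟩
  · intro γ _ hlim
    ext x
    simp only [Set.mem_iUnion, hmemF, exists_prop]
    constructor
    · rintro ⟨β, hβ, hx⟩
      exact ⟨β + 1, hlim.add_one_lt hβ, β, Order.lt_add_one_iff.2 le_rfl, hx⟩
    · rintro ⟨β, hβ, δ, hδ, hx⟩
      exact ⟨δ, hδ.trans hβ, hx⟩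
  · ext x
    simp [hmemF]
  · intro α hα
    rw [hslice α hα]
    exact hSc α hα
  · intro α hα
    rw [hslice α hα, hSF]
    exact (hDd _ (hFc α hα)).trans (closure_mono fun x hx => .inl (.inl hx))
  · ext x
    simp only [Set.mem_iUnion, exists_prop]
    constructor
    · intro hx
      obtain ⟨α, hα, h⟩ := he ⟨x, hx⟩
      refine ⟨α + 1, (Cardinal.isSuccLimit_omega 1).add_one_lt hα, hmemF.2 ?_⟩
      by_cases hxF : x ∈ F α
      · obtain ⟨β, hβ, hx⟩ := hmemF.1 hxF
        exact ⟨β, hβ.trans (Order.lt_add_one_iff.2 le_rfl), hx⟩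
      · refine ⟨α, Order.lt_add_one_iff.2 le_rfl, ?_⟩
        rw [hSF]
        exact .inl (.inr ⟨by simp [h], hxF⟩)
    · rintro ⟨α, hα, hx⟩
      obtain ⟨β, hβ, hx⟩ := hmemF.1 hx
      exact (hSA β (hβ.trans hα) hx).1
  · intro α hα
    refine ⟨hFc α hα, ?_⟩
    rw [hslice α hα, hSF]
    exact Set.subset_union_right
  · intro α hα β hβ x hxα hxβ
    rw [hslice α hα] at hxα
    rw [hslice β hβ] at hxβ
    rcases lt_trichotomy α β with h | h | h
    · exact ((hSA β hβ hxβ).2 (hmemF.2 ⟨α, h, hxα⟩)).elim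
    · exact h
    · exact ((hSA α hα hxα).2 (hmemF.2 ⟨β, h, hxβ⟩)).elim

/-! ### Order isomorphisms between subsets of `A` and `A*` in the extension -/

section Near

variable {Q : Type u} [Preorder Q]

open SetFormula

/-- `p` forces that the isomorphism `f : A' → B'` maps `a` to `-b`. -/
def ForcesReflects (A' B' f : ForcingName Q) (a b : ℝ) (p : Q) : Prop :=
  ForcesMem (check (realPSet a)) A' p ∧ ForcesMem (check (realPSet (-b))) B' p ∧
    Forces p (pairMem (check (realPSet a)) (check (realPSet (-b))) f)

theorem ForcesReflects.mono {A' B' f : ForcingName Q} {a b : ℝ} {p q : Q}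
    (h : ForcesReflects A' B' f a b p) (hq : q ≤ p) : ForcesReflects A' B' f a b q :=
  ⟨h.1.mono hq, h.2.1.mono hq, h.2.2.mono hq⟩

/-- The order of ground model reals is absolute, so what `p` forces about `f` is true outright; the
sign in `-b` reverses it. -/
theorem ForcesReflects.lt_iff {A' B' f : ForcingName Q} {a b a' b' : ℝ} {p : Q}
    (hf : Forces p (isOrderIso f A' B')) (h : ForcesReflects A' B' f a b p)
    (h' : ForcesReflects A' B' f a' b' p) : a < a' ↔ b' < b := by
  have key := hf.2 _ p le_rfl h.1 _ p le_rfl h'.1 _ p le_rfl h.2.1 _ p le_rfl h'.2.1 p le_rfl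
    ⟨h.2.2, h'.2.2⟩
  have key' : a < a' ↔ -b < -b' :=
    ⟨fun hlt => forces_ssubset_realPSet_iff.1
      (key.1 p le_rfl (forces_ssubset_realPSet_iff.2 hlt)),
    fun hlt => forces_ssubset_realPSet_iff.1
      (key.2 p le_rfl (forces_ssubset_realPSet_iff.2 hlt))⟩
  rw [key', neg_lt_neg_iff]

theorem ForcesReflects.eq_iff {A' B' f : ForcingName Q} {a b a' b' : ℝ} {p : Q}
    (hf : Forces p (isOrderIso f A' B')) (h : ForcesReflects A' B' f a b p)
    (h' : ForcesReflects A' B' f a' b' p) : a = a' ↔ b = b' := by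
  have h1 := h.lt_iff hf h'
  have h2 := h'.lt_iff hf h
  constructor <;> rintro rfl <;> apply le_antisymm <;> simp_all

theorem exists_forcesReflects {A : Set ℝ} {A' B' f x : ForcingName Q} {p : Q}
    (hA' : Forces p (subset A' (check (realSetPSet A))))
    (hB' : Forces p (subset B' (check (realSetPSet (reverseOrder A)))))
    (hf : Forces p (isOrderIso f A' B')) (hx : ForcesMem x A' p) :
    ∃ q ≤ p, ∃ a ∈ A, ∃ b ∈ A, ForcesEq x (check (realPSet a)) q ∧
      ForcesReflects A' B' f a b q := by
  obtain ⟨q₁, l₁, s, hs, e₁⟩ :=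
    ForcesMem.exists_mem (hA' x p le_rfl hx)
  obtain ⟨a, ha, hsa⟩ := mem_realSetPSet_iff.1 hs
  obtain ⟨q₂, l₂, y, hy, hxy, -⟩ := hf.1.1.1.2 x q₁ l₁ (hx.mono l₁) q₁ le_rfl
  obtain ⟨q₃, l₃, t, ht, e₂⟩ :=
    ForcesMem.exists_mem (hB' y q₂ (l₂.trans l₁) hy)
  obtain ⟨_, ⟨b, hb, rfl⟩, htb⟩ := mem_realSetPSet_iff.1 ht
  have ex : ForcesEq x (check (realPSet a)) q₃ :=
    (e₁.mono (l₃.trans l₂)).trans (forcesEq_check_iff.2 hsa)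
  have ey : ForcesEq y (check (realPSet (-b))) q₃ := e₂.trans (forcesEq_check_iff.2 htb)
  exact ⟨q₃, l₃.trans (l₂.trans l₁), a, ha, b, hb, ex,
    (hx.mono (l₃.trans (l₂.trans l₁))).congr_left ex, (ForcesMem.mono hy l₃).congr_left ey,
    (hxy.mono l₃).pairMem_congr ex ey⟩

theorem exists_forcesReflects_notMem {A C : Set ℝ} (hC : C.Countable) {A' B' f : ForcingName Q}
    {p : Q} (hA' : Forces p (subset A' (check (realSetPSet A))))
    (hB' : Forces p (subset B' (check (realSetPSet (reverseOrder A)))))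
    (hunc : Forces p (isUncountable (check PSet.omega) A'))
    (hf : Forces p (isOrderIso f A' B')) :
    ∃ q ≤ p, ∃ a ∈ A \ C, ∃ b ∈ A \ C, ForcesReflects A' B' f a b q := by
  by_contra! hno
  obtain ⟨e, he⟩ := Set.countable_iff_exists_injOn.1 hC
  -- Points of `A'` in `C` get even codes, the others odd codes through their images. By `hno` those
  -- images have `b ∈ C`, where `e` is injective, and `f` is injective too.
  refine hunc p le_rfl (forces_exists_injection (fun x n q => q ≤ p ∧ ∃ a b, a ∈ A ∧ b ∈ A ∧
    ForcesEq x (check (realPSet a)) q ∧ ForcesReflects A' B' f a b q ∧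
      ((a ∈ C ∧ n = 2 * e a) ∨ (a ∉ C ∧ n = 2 * e b + 1))) ?_ ?_ ?_ ?_)
  · rintro x n q r ⟨hq, a, b, ha, hb, hx, h, hn⟩ hr
    exact ⟨hr.trans hq, a, b, ha, hb, hx.mono hr, h.mono hr, hn⟩
  · rintro x y n q ⟨hq, a, b, ha, hb, hx, h, hn⟩ hxy
    exact ⟨hq, a, b, ha, hb, hxy.symm.trans hx, h, hn⟩
  · intro x q hq hx
    obtain ⟨r, hr, a, ha, b, hb, ex, h⟩ :=
      exists_forcesReflects (hA'.mono hq) (hB'.mono hq) (hf.mono hq) hx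
    by_cases haC : a ∈ C
    · exact ⟨r, hr, 2 * e a, hr.trans hq, a, b, ha, hb, ex, h, .inl ⟨haC, rfl⟩⟩
    · exact ⟨r, hr, 2 * e b + 1, hr.trans hq, a, b, ha, hb, ex, h, .inr ⟨haC, rfl⟩⟩
  · rintro x y n q ⟨hq, a, b, ha, hb, hx, h, hn⟩ ⟨-, a', b', ha', hb', hy, h', hn'⟩
    suffices a = a' by
      subst this
      exact hx.trans hy.symm
    have hmem : ∀ {a b}, a ∈ A → b ∈ A → a ∉ C → ForcesReflects A' B' f a b q → b ∈ C := by
      intro a b ha hb haC h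
      by_contra hbC
      exact hno q hq a ⟨ha, haC⟩ b ⟨hb, hbC⟩ h
    rcases hn with ⟨haC, hn⟩ | ⟨haC, hn⟩ <;> rcases hn' with ⟨haC', hn'⟩ | ⟨haC', hn'⟩
    · exact he haC haC' (by omega)
    · omega
    · omega
    · exact (h.eq_iff (hf.mono hq) h').2
        (he (hmem ha hb haC h) (hmem ha' hb' haC' h') (by omega))

/-- If a slicewise coverable set and its reverse are near in an extension by a forcing notion of
size `ℵ₁`, then the extension collapses `ω₁`. -/
theorem SlicewiseCoverable.forces_exists_injection {A : Set ℝ} (hA : Dense A)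
    (hcov : SlicewiseCoverable A) (hcard : #Q ≤ ℵ₁) {A' B' f : ForcingName Q}
    {p : Q} (hA' : Forces p (subset A' (check (realSetPSet A))))
    (hB' : Forces p (subset B' (check (realSetPSet (reverseOrder A)))))
    (hunc : Forces p (isUncountable (check PSet.omega) A'))
    (hf : Forces p (isOrderIso f A' B')) :
    Forces p (.ex fun g => isInjection g (check (Ordinal.omega 1).toPSet) (check PSet.omega)) := by
  have : Nonempty Q := ⟨p⟩
  obtain ⟨c, hc⟩ := exists_enumeration_of_card_le_aleph_one hcard
  have hwit : ∀ q : Q, ∀ C : Set ℝ, q ≤ p → C.Countable → ∃ a b : ℝ, a ∈ A \ C ∧ b ∈ A \ C ∧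
      ∃ r ≤ q, ForcesReflects A' B' f a b r := by
    intro q C hq hC
    obtain ⟨r, hr, a, ha, b, hb, h⟩ := exists_forcesReflects_notMem hC (hA'.mono hq) (hB'.mono hq)
      (hunc.mono hq) (hf.mono hq)
    exact ⟨a, b, ha, hb, r, hr, h⟩
  choose! a b ha hb hab using hwit
  -- Only conditions with index `β < α` are served at `α`, which keeps the prescribed part
  -- countable.
  obtain ⟨F, hF, hWF, hdisj⟩ := hcov.1.exists_filtration hA
    (fun α C => ⋃ β < α, {x | c β ≤ p ∧ (x = a (c β) C ∨ x = b (c β) C)}) (by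
      intro α hα C hC
      constructor
      · refine (countable_Iio_of_lt_omega_one hα).biUnion fun β _ => ?_
        refine (Set.toFinite {a (c β) C, b (c β) C}).countable.mono ?_
        rintro x ⟨-, hx⟩
        exact hx
      · simp only [Set.iUnion_subset_iff]
        rintro β - x ⟨hβ, rfl | rfl⟩
        · exact ha _ _ hβ hC
        · exact hb _ _ hβ hC)
  obtain ⟨g, hg, hgU⟩ := hcov.2 F hF
  have henc : ∀ α : Ordinal.{0}, ∃ e : Ordinal.{0} → ℕ, α < Ordinal.omega 1 →
      Set.InjOn e (Set.Iio α) := by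
    intro α
    by_cases hα : α < Ordinal.omega 1
    · obtain ⟨e, he⟩ := Set.countable_iff_exists_injOn.1 (countable_Iio_of_lt_omega_one hα)
      exact ⟨e, fun _ => he⟩
    · exact ⟨fun _ => 0, fun h => (hα h).elim⟩
  choose e he using henc
  -- The code of `ξ` pairs an `n` for which the reflected graph of `f` meets `g n` in the slice of
  -- some `α > ξ` with the number of `ξ` in a ground model enumeration of `α`.
  refine _root_.forces_exists_injection (fun x m q => q ≤ p ∧ ∃ ξ α : Ordinal.{0}, ∃ n y z,
    ξ < α ∧ α < Ordinal.omega 1 ∧ ForcesEq x (check (Ordinal.lift.{u} ξ).toPSet) q ∧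
    (y, z) ∈ g n ∧ y ∈ slice F α ∧ ForcesReflects A' B' f y z q ∧
    m = Nat.pair n (e α ξ)) ?_ ?_ ?_ ?_
  · rintro x m q r ⟨hq, ξ, α, n, y, z, hξ, hα, hx, hg, hy, h, hm⟩ hr
    exact ⟨hr.trans hq, ξ, α, n, y, z, hξ, hα, hx.mono hr, hg, hy, h.mono hr, hm⟩
  · rintro x x' m q ⟨hq, ξ, α, n, y, z, hξ, hα, hx, hg, hy, h, hm⟩ e
    exact ⟨hq, ξ, α, n, y, z, hξ, hα, e.symm.trans hx, hg, hy, h, hm⟩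
  · intro x q hq hx
    obtain ⟨r, hr, s, hs, ex⟩ := hx.exists_mem
    obtain ⟨ζ, hζ, hsζ⟩ := Ordinal.mem_toPSet_iff.1 hs
    -- The filtration is indexed in universe `0`; every ordinal below `ω₁` of universe `u` is a lift
    -- from there.
    rw [← Ordinal.lift_one.{0, u}, ← Ordinal.lift_omega.{0, u}, Ordinal.lt_lift_iff] at hζ
    obtain ⟨ξ, hξ, rfl⟩ := hζ
    obtain ⟨β, hβ, rfl⟩ := hc r
    -- The index must lie strictly above `ξ`, so that `e α` numbers `ξ`, and strictly above `β`, so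
    -- that the witnesses for `c β` are in the slice.
    have hα : max ξ β + 1 < Ordinal.omega 1 :=
      (Cardinal.isSuccLimit_omega 1).add_one_lt (max_lt hξ hβ)
    have hlt : ∀ {γ}, γ ≤ max ξ β → γ < max ξ β + 1 := fun h => Order.lt_add_one_iff.2 h
    obtain ⟨hFα, hWα⟩ := hWF _ hα
    set α := max ξ β + 1
    have hya : a (c β) (F α) ∈ slice F α := hWα <| Set.mem_biUnion
      (show β ∈ Set.Iio α from hlt (le_max_right _ _)) ⟨hr.trans hq, .inl rfl⟩
    have hzb : b (c β) (F α) ∈ slice F α := hWα <| Set.mem_biUnion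
      (show β ∈ Set.Iio α from hlt (le_max_right _ _)) ⟨hr.trans hq, .inr rfl⟩
    obtain ⟨t, ht, h⟩ := hab (c β) (F α) (hr.trans hq) hFα
    have hmem : (a (c β) (F α), b (c β) (F α)) ∈ ⋃ n, g n := by
      rw [hgU]
      exact Set.mem_biUnion (show α ∈ Set.Iio (Ordinal.omega 1) from hα) ⟨hya, hzb⟩
    obtain ⟨n, hn⟩ := Set.mem_iUnion.1 hmem
    exact ⟨t, ht.trans hr, _, ht.trans (hr.trans hq), ξ, α, n, _, _, hlt (le_max_left _ _), hα,
      (ex.mono ht).trans (forcesEq_check_iff.2 hsζ), hn, hya, h, rfl⟩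
  · rintro x x' m q ⟨hq, ξ, α, n, y, z, hξ, hα, hx, hyz, hy, h, hm⟩
      ⟨-, ξ', α', n', y', z', hξ', hα', hx', hyz', hy', h', hm'⟩
    rw [hm, Nat.pair_eq_pair] at hm'
    obtain ⟨rfl, hm'⟩ := hm'
    -- Both points lie on the increasing `g n` and on the decreasing reflected graph of `f`, so they
    -- coincide. As slices are disjoint, `y` determines `α`, and then `e α` determines `ξ`.
    have hyy : y = y' := by
      rcases lt_trichotomy y y' with hlt | heq | hlt
      · exact (((h.lt_iff (hf.mono hq) h').1 hlt).not_gt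
          ((hg n).increasing _ _ _ _ hyz hyz' hlt)).elim
      · exact heq
      · exact (((h'.lt_iff (hf.mono hq) h).1 hlt).not_gt
          ((hg n).increasing _ _ _ _ hyz' hyz hlt)).elim
    subst hyy
    obtain rfl := hdisj α hα α' hα' y hy hy'
    obtain rfl := he α hα hξ hξ' hm'
    exact hx.trans hx'.symm

end Near

/-- If `A ⊆ ℝ` is dense in `ℝ`, `ℵ₁`-dense and slicewise coverable, then every `ℵ₁`-preserving
forcing notion `Q` of size `ℵ₁` forces that `A` and `A*` are far. -/
theorem mainTheorem3 (A : Set ℝ) (hA : Dense A) (hA₁ : IsAlephOneDense A)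
    (hcov : SlicewiseCoverable A) (Q : Type u) [Preorder Q] (hcard : #Q = ℵ₁)
    (hpres : PreservesAlephOne Q) :
    ForcedBy Q (.far (.check PSet.omega) (.check (realSetPSet A))
      (.check (realSetPSet (reverseOrder A)))) := by
  intro p q _ h
  obtain ⟨r, -, A', h⟩ := h q le_rfl
  obtain ⟨r, -, B', ⟨hA', hB'⟩, ⟨hunc, -⟩, h⟩ := h r le_rfl
  obtain ⟨s, hs, f, hf⟩ := h r le_rfl
  exact hpres s s le_rfl (hcov.forces_exists_injection hA hcard.le (hA'.mono hs) (hB'.mono hs)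
    (hunc.mono hs) hf)
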